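/- Let $\lambda>0$ and $\alpha>0$. Jobs arrive at a single server according to a Poisson process of rate $\lambda$ (i.i.d. exponential inter-arrival times of rate $\lambda$); independently of the arrivals, the job sizes are i.i.d. exponential with unit mean. Jobs are served one after the other, and $n_0\in\{0,1,2,\dots\}$ jobs (also with sizes of this kind) are present at time $0$. Let $n(t)$ be the number of jobs in the system at time $t$. Under a policy $(\mu_i)_{i\ge 0}$ with $\mu_i\ge 0$ and $\mu_0=0$ the server works at speed $s(t)=\mu_{n(t)}$ at every time $t$; that is, if $T_1<T_2<\cdots$ are the arrival times and $W_k$ is the sum of the sizes of the first $k$ jobs served, then for all $t\ge 0$ $$n(t)=n_0+\#\{k\ge 1: T_k\le t\}-\#\Big\{k\ge 1: W_k\le \int_0^t\mu_{n(u)}\,du\Big\}.$$ Let $\mathrm{SC}(t)=\sum_{0<u\le t}\big(s(u)-s(u-)\big)^2$ be the total quadratic switching cost over $[0,t]$, the sum of the squared jumps of the piecewise constant function $s$. The long-run cost of the policy is the almost sure limit $$C=\lim_{t\to\infty}\left[\frac1t\int_0^t n(u)\,du+\alpha\,\frac{\mathrm{SC}(t)}{t}\right].$$ Claim. For the proportional-speed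 policy $\mu_i=i/\sqrt[3]{4\alpha}$, $i\ge 0$, and every $n_0$, almost surely the displayed equation for $n(\cdot)$ has a solution, and along every solution the limit above exists and equals $$C=\tfrac32\,\sqrt[3]{4\alpha}\;\lambda .$$ -/

import Mathlib

open MeasureTheory ProbabilityTheory Filter Topology
open scoped ENNReal

namespace SpeedScaling

/-- The random input of the queue on the probability space `(Ω, P)`: `gap k` is the time between the
`k`-th and the `(k+1)`-st arrival instant (the `0`-th being time `0`), and `size k` is the size of
the `k`-th job to be served. Arrivals form a Poisson process of rate `lam` (i.i.d. exponential gaps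
of rate `lam`), sizes are i.i.d. exponential with unit mean, and the two are independent. -/
structure IsPoissonExpInput {Ω : Type*} [MeasurableSpace Ω] (P : Measure Ω) (lam : ℝ)
    (gap size : ℕ → Ω → ℝ) : Prop where
  gap_law : ∀ k, HasLaw (gap k) (expMeasure lam) P
  size_law : ∀ k, HasLaw (size k) (expMeasure 1) P
  indep : iIndepFun (fun i : ℕ ⊕ ℕ => Sum.elim gap size i) P

/-- The number of indices `k` with `x 0 + ⋯ + x k ≤ y`. -/
noncomputable def countUpTo (x : ℕ → ℝ) (y : ℝ) : ℕ∞ :=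
  {k : ℕ | ∑ i ∈ Finset.range (k + 1), x i ≤ y}.encard

/-- A Markovian policy of the single-server speed-scaling model: `rate i ∈ [0, ∞)` is the service
rate when there are `i` jobs in the system; it vanishes when the system is empty. -/
structure Policy where
  rate : ℕ → ℝ
  rate_nonneg : ∀ i, 0 ≤ rate i
  rate_zero : rate 0 = 0

/-- `n t` is the number of jobs in the system at time `t ≥ 0` when the server starts with `n₀` jobs,
jobs arrive with inter-arrival times `gap`, are served one after the other and have (in the order of
service) the sizes `size`, and the server works at speed `p.rate (n t)` at time `t`: the number of
departures by time `t` is the number of jobs completed by the work `∫₀ᵗ p.rate (n u) du` done so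
far, and the number present is `n₀` plus the number of arrivals minus the number of departures. -/
structure IsOccupancyPath (p : Policy) (n₀ : ℕ) (gap size : ℕ → ℝ) (n : ℝ → ℕ) : Prop where
  measurable : Measurable n
  balance : ∀ t : ℝ, 0 ≤ t →
    (n t : ℕ∞) + countUpTo size (∫ u in (0 : ℝ)..t, p.rate (n u)) = n₀ + countUpTo gap t

/-- The total quadratic switching cost of the piecewise constant speed function `s` over `[0, t]`:
every jump of `s`, from `s(u-)` to `s(u)`, costs `(s(u) - s(u-))²`. -/
noncomputable def switchingCost (s : ℝ → ℝ) (t : ℝ) : ℝ≥0∞ :=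
  ∑' u : Set.Ioc (0 : ℝ) t, ENNReal.ofReal ((s u - Function.leftLim s u) ^ 2)

/-- `(1/t) ∫₀ᵗ n(u) du + α SC(t)/t`, the average cost over `[0, t]` along the path `n`. -/
noncomputable def averageCost (α : ℝ) (p : Policy) (n : ℝ → ℕ) (t : ℝ) : ℝ≥0∞ :=
  (∫⁻ u in Set.Icc (0 : ℝ) t, (n u : ℝ≥0∞)) / ENNReal.ofReal t
    + ENNReal.ofReal α * (switchingCost (fun u => p.rate (n u)) t / ENNReal.ofReal t)

/-- The policy `p`, started with `n₀` jobs, has the (finite, deterministic) long-run cost `C`: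
almost surely the dynamics of the queue have a solution, and along every solution the average cost
over `[0, t]` tends to `C` as `t → ∞`. -/
def HasLongRunCost {Ω : Type*} [MeasurableSpace Ω] (P : Measure Ω) (gap size : ℕ → Ω → ℝ)
    (α : ℝ) (p : Policy) (n₀ : ℕ) (C : ℝ) : Prop :=
  0 ≤ C ∧ ∀ᵐ ω ∂P,
    (∃ n : ℝ → ℕ, IsOccupancyPath p n₀ (fun k => gap k ω) (fun k => size k ω) n) ∧
    ∀ n : ℝ → ℕ, IsOccupancyPath p n₀ (fun k => gap k ω) (fun k => size k ω) n →
      Tendsto (averageCost α p n) atTop (𝓝 (ENNReal.ofReal C))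

/-- The proportional-speed policy `μ_i = i / (4α)^{1/3}`. -/
noncomputable def proportionalSpeed (α : ℝ) (hα : 0 < α) : Policy where
  rate i := (i : ℝ) / (4 * α) ^ (1 / 3 : ℝ)
  rate_nonneg i := by positivity
  rate_zero := by simp

end SpeedScaling

namespace SpeedScaling

/-! The argument is pathwise. Put `c = (4α)^(1/3)`, and let `A`, `D` count arrivals and departures.
Since the speed is `n / c`, the holding cost up to `t` is exactly `c` times the work done
(`lintegral_occupancy`). If no arrival coincides with a departure, each event moves the speed by `1
/ c`, so the switching cost is `(A + D) / c ^ 2` (`switchingCost_eq`). No stationary distribution is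
needed: only the rates of `A`, `D` and the work matter.

The strong law gives `A(t) / t → lam`. As speed grows with the queue, a backlog of linear order
cannot persist, so `D(t) / t → lam` (`tendsto_jumpCount_workDone_div`). Sizes have mean one, hence
work also has rate `lam` (`tendsto_workDone_div`). The limit is `(c + 2α / c ^ 2) * lam`, and `c ^ 3
= 4α` makes it `3 / 2 * c * lam`.

Departure instants are built recursively as hitting times of the work; every solution has these
departures (`le_workDone_iff`), and they do define a solution (`occupancy_balance`). A tie would
force a job size to equal a variable independent of it, which has probability zero
(`ae_departure_ne`). -/

/-- A sequence of jump instants `0 = y 0 < y 1 < ⋯` without accumulation point. -/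
structure IsJumpSequence (y : ℕ → ℝ) : Prop where
  strictMono : StrictMono y
  zero : y 0 = 0
  tendsto : Tendsto y atTop atTop

/-- The number of jump instants `y 1, y 2, …` up to time `t`. -/
noncomputable def jumpCount (y : ℕ → ℝ) (t : ℝ) : ℕ := {k : ℕ | y (k + 1) ≤ t}.ncard

/-- The partial sums `0, x 0, x 0 + x 1, …`. -/
def partialSum (x : ℕ → ℝ) (m : ℕ) : ℝ := ∑ i ∈ Finset.range m, x i

/-! ### Counting functions of jump sequences. -/

namespace IsJumpSequence

variable {y z : ℕ → ℝ}

theorem finite_le (hy : IsJumpSequence y) (t : ℝ) : {k : ℕ | y (k + 1) ≤ t}.Finite := by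
  have h := (hy.tendsto.comp (tendsto_add_atTop_nat 1)).eventually_gt_atTop t
  rw [← Nat.cofinite_eq_atTop] at h
  simpa [Filter.eventually_cofinite] using h

theorem finite_eq (hy : IsJumpSequence y) (t : ℝ) : {k : ℕ | y (k + 1) = t}.Finite :=
  (hy.finite_le t).subset fun _ (hk : _ = t) => hk.le

theorem coe_jumpCount (hy : IsJumpSequence y) (t : ℝ) :
    (jumpCount y t : ℕ∞) = {k : ℕ | y (k + 1) ≤ t}.encard :=
  (hy.finite_le t).cast_ncard_eq

/-- By monotonicity the counted indices form an initial segment. This Galois-type relation is what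
later arguments use in place of the cardinality. -/
theorem le_jumpCount_iff (hy : IsJumpSequence y) {t : ℝ} (ht : 0 ≤ t) {m : ℕ} :
    m ≤ jumpCount y t ↔ y m ≤ t := by
  constructor
  · intro h
    by_contra! hlt
    have hm : m ≠ 0 := by rintro rfl; linarith [hy.zero]
    have hsub : {k : ℕ | y (k + 1) ≤ t} ⊆ (Finset.range (m - 1) : Set ℕ) := by
      intro k hk
      have : k + 1 < m := hy.strictMono.lt_iff_lt.1 (lt_of_le_of_lt hk hlt)
      simp only [Finset.coe_range, Set.mem_Iio]
      omega
    have := Set.ncard_le_ncard hsub (Finset.finite_toSet _)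
    rw [Set.ncard_coe_finset, Finset.card_range] at this
    unfold jumpCount at h
    omega
  · intro h
    have hsub : (Finset.range m : Set ℕ) ⊆ {k : ℕ | y (k + 1) ≤ t} := by
      intro k hk
      have : k + 1 ≤ m := by simpa using hk
      exact (hy.strictMono.monotone this).trans h
    have := Set.ncard_le_ncard hsub (hy.finite_le t)
    rwa [Set.ncard_coe_finset, Finset.card_range] at this

theorem jumpCount_eq (hy : IsJumpSequence y) {t : ℝ} (ht : 0 ≤ t) {m : ℕ} (h₁ : y m ≤ t)
    (h₂ : t < y (m + 1)) : jumpCount y t = m := by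
  refine le_antisymm ?_ ((hy.le_jumpCount_iff ht).2 h₁)
  by_contra! h
  exact absurd ((hy.le_jumpCount_iff ht).1 h) (not_le.2 h₂)

theorem apply_jumpCount_le (hy : IsJumpSequence y) {t : ℝ} (ht : 0 ≤ t) :
    y (jumpCount y t) ≤ t := (hy.le_jumpCount_iff ht).1 le_rfl

theorem lt_apply_jumpCount_succ (hy : IsJumpSequence y) {t : ℝ} (ht : 0 ≤ t) :
    t < y (jumpCount y t + 1) := by
  by_contra! h
  have := (hy.le_jumpCount_iff ht).2 h
  omega

theorem nonneg (hy : IsJumpSequence y) (m : ℕ) : 0 ≤ y m :=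
  hy.zero ▸ hy.strictMono.monotone (Nat.zero_le m)

theorem monotone_jumpCount (hy : IsJumpSequence y) : Monotone (jumpCount y) := fun _ t hst =>
  Set.ncard_le_ncard (fun _ hk => le_trans hk hst) (hy.finite_le t)

theorem measurable_jumpCount (hy : IsJumpSequence y) : Measurable (jumpCount y) :=
  hy.monotone_jumpCount.measurable

theorem tendsto_jumpCount (hy : IsJumpSequence y) : Tendsto (jumpCount y) atTop atTop :=
  tendsto_atTop.2 fun m => by
    filter_upwards [eventually_ge_atTop (y m), eventually_ge_atTop 0] with t ht ht0
    exact (hy.le_jumpCount_iff ht0).2 ht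

/-- The elementary renewal theorem along a path. -/
theorem tendsto_jumpCount_div (hy : IsJumpSequence y) {a : ℝ} (ha : 0 < a)
    (h : Tendsto (fun m : ℕ => y m / m) atTop (𝓝 a)) :
    Tendsto (fun t => (jumpCount y t : ℝ) / t) atTop (𝓝 a⁻¹) := by
  have h₁ : Tendsto (fun t => y (jumpCount y t) / jumpCount y t) atTop (𝓝 a) :=
    h.comp hy.tendsto_jumpCount
  have h₂ : Tendsto (fun m : ℕ => y (m + 1) / m) atTop (𝓝 a) := by
    have h₃ : Tendsto (fun m : ℕ => y (m + 1) / ((m + 1 : ℕ) : ℝ) * (1 + 1 / (m : ℝ))) atTop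
        (𝓝 (a * (1 + 0))) :=
      (h.comp (tendsto_add_atTop_nat 1)).mul
        (tendsto_const_nhds.add tendsto_one_div_atTop_nhds_zero_nat)
    rw [add_zero, mul_one] at h₃
    refine h₃.congr' ?_
    filter_upwards [eventually_gt_atTop 0] with m hm
    have : (0 : ℝ) < m := by exact_mod_cast hm
    push_cast
    field_simp
  have h₃ : Tendsto (fun t => y (jumpCount y t + 1) / jumpCount y t) atTop (𝓝 a) :=
    h₂.comp hy.tendsto_jumpCount
  have h₄ : Tendsto (fun t => t / (jumpCount y t : ℝ)) atTop (𝓝 a) := by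
    refine tendsto_of_tendsto_of_tendsto_of_le_of_le' h₁ h₃ ?_ ?_
    · filter_upwards [eventually_ge_atTop 0] with t ht
      exact div_le_div_of_nonneg_right (hy.apply_jumpCount_le ht) (Nat.cast_nonneg _)
    · filter_upwards [eventually_ge_atTop 0] with t ht
      exact div_le_div_of_nonneg_right (hy.lt_apply_jumpCount_succ ht).le (Nat.cast_nonneg _)
  simpa using h₄.inv₀ ha.ne'

/-- Just before `u > 0` the counting function is constant, one less than at `u` if `u` is a jump
instant. -/
theorem eventually_jumpCount_add (hy : IsJumpSequence y) (u : ℝ) :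
    ∀ᶠ s in 𝓝[<] u, jumpCount y s + {k : ℕ | y (k + 1) = u}.ncard = jumpCount y u := by
  have hfin : {k : ℕ | y (k + 1) < u}.Finite := (hy.finite_le u).subset fun k (hk : y (k + 1) < u) => hk.le
  have h : ∀ᶠ s in 𝓝[<] u, ∀ k ∈ {k : ℕ | y (k + 1) < u}, y (k + 1) ≤ s := by
    rw [hfin.eventually_all]
    intro k hk
    exact mem_nhdsWithin_of_mem_nhds (Ici_mem_nhds hk)
  filter_upwards [h, self_mem_nhdsWithin] with s hs hsu
  have hsu : s < u := hsu
  unfold jumpCount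
  rw [← Set.ncard_union_eq _ (hy.finite_le s) (hy.finite_eq u)]
  · congr 1
    ext k
    simp only [Set.mem_union, Set.mem_ofPred_eq]
    constructor
    · rintro (h | h) <;> linarith
    · intro h
      exact h.lt_or_eq.imp (fun h => hs k h) id
  · rw [Set.disjoint_left]
    rintro k (hk : _ ≤ s) (hk' : _ = u)
    linarith

theorem ncard_eq_le_one (hy : IsJumpSequence y) (u : ℝ) : {k : ℕ | y (k + 1) = u}.ncard ≤ 1 := by
  refine (Set.ncard_le_one (hy.finite_eq u)).2 ?_
  intro a ha b hb
  have := hy.strictMono.injective (Eq.trans ha (Eq.symm hb))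
  omega

/-- Tonelli: writing each cardinality as a sum of indicators and exchanging the sums leaves one unit
per jump instant in the interval. -/
theorem tsum_ncard_eq (hy : IsJumpSequence y) (t : ℝ) :
    ∑' u : Set.Ioc (0 : ℝ) t, (({k : ℕ | y (k + 1) = u}.ncard : ℕ) : ℝ≥0∞) = jumpCount y t := by
  have h₁ : ∀ u : Set.Ioc (0 : ℝ) t, (({k : ℕ | y (k + 1) = u}.ncard : ℕ) : ℝ≥0∞) =
      ∑' k : ℕ, if y (k + 1) = u then 1 else 0 := by
    intro u
    have hf : {k : ℕ | y (k + 1) = u}.Finite := hy.finite_eq u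
    have h := ENNReal.tsum_set_one {k : ℕ | y (k + 1) = u}
    rw [← hf.cast_ncard_eq, tsum_subtype {k : ℕ | y (k + 1) = u} (fun _ => (1 : ℝ≥0∞))] at h
    rw [← ENat.toENNReal_coe, ← h]
    simp [Set.indicator_apply]
  have h₂ : ∀ k : ℕ, (∑' u : Set.Ioc (0 : ℝ) t, if y (k + 1) = u then (1 : ℝ≥0∞) else 0) =
      if y (k + 1) ≤ t then 1 else 0 := by
    intro k
    split_ifs with h
    · have hpos : 0 < y (k + 1) := hy.zero ▸ hy.strictMono (Nat.succ_pos k)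
      rw [tsum_eq_single (⟨y (k + 1), hpos, h⟩ : Set.Ioc (0 : ℝ) t)]
      · simp
      · intro b hb
        rw [if_neg]
        rintro he
        exact hb (Subtype.ext he.symm)
    · refine ENNReal.tsum_eq_zero.2 fun u => if_neg ?_
      rintro he
      exact h (he ▸ u.2.2)
  simp_rw [h₁]
  rw [ENNReal.tsum_comm]
  simp_rw [h₂]
  have h := ENNReal.tsum_set_one {k : ℕ | y (k + 1) ≤ t}
  rw [← (hy.finite_le t).cast_ncard_eq, tsum_subtype {k : ℕ | y (k + 1) ≤ t} (fun _ => (1 : ℝ≥0∞))] at h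
  rw [jumpCount, ← ENat.toENNReal_coe, ← h]
  simp [Set.indicator_apply]

end IsJumpSequence

/-! ### Partial sums and the switching cost. -/

theorem isJumpSequence_partialSum {x : ℕ → ℝ} (hx : ∀ k, 0 < x k) {a : ℝ} (ha : 0 < a)
    (h : Tendsto (fun m : ℕ => partialSum x m / m) atTop (𝓝 a)) :
    IsJumpSequence (partialSum x) where
  strictMono := strictMono_nat_of_lt_succ fun m => by
    simpa [partialSum, Finset.sum_range_succ] using hx m
  zero := by simp [partialSum]
  tendsto := by
    refine (h.pos_mul_atTop ha tendsto_natCast_atTop_atTop).congr' ?_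
    filter_upwards [eventually_gt_atTop 0] with m hm
    have : (m : ℝ) ≠ 0 := by exact_mod_cast hm.ne'
    field_simp

theorem countUpTo_eq {x : ℕ → ℝ} (hx : IsJumpSequence (partialSum x)) (t : ℝ) :
    countUpTo x t = (jumpCount (partialSum x) t : ℕ∞) := (hx.coe_jumpCount t).symm

/-- At each instant the occupancy jumps by `a - b`, with `a`, `b` in `{0, 1}` and, by `hyz`, not
both `1`; hence `(a - b) ^ 2 = a + b`. Without `hyz` a simultaneous arrival and departure would
cancel and cost nothing. -/
theorem switchingCost_eq {y z : ℕ → ℝ} (hy : IsJumpSequence y) (hz : IsJumpSequence z)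
    (hyz : ∀ i j, z (i + 1) ≠ y (j + 1)) {n₀ : ℕ} {n : ℝ → ℕ}
    (hn : ∀ t, 0 ≤ t → n t + jumpCount z t = n₀ + jumpCount y t) (c t : ℝ) :
    switchingCost (fun u => (n u : ℝ) / c) t =
      ENNReal.ofReal ((jumpCount y t + jumpCount z t : ℝ) / c ^ 2) := by
  have key : ∀ u : Set.Ioc (0 : ℝ) t,
      ENNReal.ofReal (((n u : ℝ) / c - Function.leftLim (fun u => (n u : ℝ) / c) u) ^ 2) =
        ENNReal.ofReal (1 / c ^ 2) * ((({k : ℕ | y (k + 1) = u}.ncard : ℕ) : ℝ≥0∞) +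
          (({k : ℕ | z (k + 1) = u}.ncard : ℕ) : ℝ≥0∞)) := by
    rintro ⟨u, hu0, hut⟩
    simp only
    set a := {k : ℕ | y (k + 1) = u}.ncard with ha
    set b := {k : ℕ | z (k + 1) = u}.ncard with hb
    have hlim : Function.leftLim (fun u => (n u : ℝ) / c) u = ((n u : ℝ) - a + b) / c := by
      refine leftLim_eq_of_tendsto (h := by infer_instance) (tendsto_nhds_of_eventually_eq ?_)
      filter_upwards [hy.eventually_jumpCount_add u, hz.eventually_jumpCount_add u,
        mem_nhdsWithin_of_mem_nhds (Ioi_mem_nhds hu0)] with s h₁ h₂ h₃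
      have h₄ := hn s (le_of_lt h₃)
      have h₅ := hn u hu0.le
      have : (n s : ℝ) = n u - a + b := by
        rify at h₁ h₂ h₄ h₅
        linarith
      rw [this]
    have hab : a * b = 0 := by
      by_contra h
      obtain ⟨h₁, h₂⟩ := mul_ne_zero_iff.1 h
      obtain ⟨i, hi⟩ := Set.nonempty_of_ncard_ne_zero h₁
      obtain ⟨j, hj⟩ := Set.nonempty_of_ncard_ne_zero h₂
      exact hyz j i (hj.trans hi.symm)
    have ha1 := hy.ncard_eq_le_one u
    have hb1 := hz.ncard_eq_le_one u
    rw [hlim, ← ha, ← hb] at *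
    have : ((n u : ℝ) / c - ((n u : ℝ) - a + b) / c) ^ 2 = 1 / c ^ 2 * ((a + b : ℕ) : ℝ) := by
      have h : ((a : ℝ) - b) ^ 2 = ((a + b : ℕ) : ℝ) := by
        interval_cases a <;> interval_cases b <;> simp_all
      rw [← h]
      ring
    rw [this, ENNReal.ofReal_mul (by positivity), ENNReal.ofReal_natCast, Nat.cast_add]
  unfold switchingCost
  simp_rw [key]
  rw [ENNReal.tsum_mul_left, ENNReal.tsum_add, hy.tsum_ncard_eq, hz.tsum_ncard_eq,
    ← Nat.cast_add, ← ENNReal.ofReal_natCast, ← ENNReal.ofReal_mul (by positivity)]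
  congr 1
  push_cast
  ring

/-! ### Departure instants as hitting times. -/

/-- The work done over `[0, t]` by a server of speed `(n₀ + A(u) - j)⁺ / c`, where `A` counts the
jump instants `y`: this is the speed after the `j`-th departure and before the next one. -/
noncomputable def stageWork (c : ℝ) (n₀ : ℕ) (y : ℕ → ℝ) (j : ℕ) (t : ℝ) : ℝ :=
  ∫ u in (0 : ℝ)..t, ((n₀ + jumpCount y u - j : ℕ) : ℝ) / c

/-- The departure instants of the queue with arrival instants `y` and accumulated sizes `w`. The
volume is that of the initial segment of times up to the next departure. -/
noncomputable def departure (c : ℝ) (n₀ : ℕ) (y w : ℕ → ℝ) : ℕ → ℝ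
  | 0 => 0
  | j + 1 => (volume {u : ℝ | 0 ≤ u ∧ stageWork c n₀ y j u <
      stageWork c n₀ y j (departure c n₀ y w j) + (w (j + 1) - w j)}).toReal

section

variable {c : ℝ} {n₀ : ℕ} {y w : ℕ → ℝ}

theorem monotone_stage (hc : 0 < c) (hy : IsJumpSequence y) (j : ℕ) :
    Monotone fun u => ((n₀ + jumpCount y u - j : ℕ) : ℝ) / c := fun s t hst => by
  have := hy.monotone_jumpCount hst
  refine div_le_div_of_nonneg_right ?_ hc.le
  exact_mod_cast (by omega)

theorem intervalIntegrable_stage (hc : 0 < c) (hy : IsJumpSequence y) (j : ℕ) (a b : ℝ) :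
    IntervalIntegrable (fun u => ((n₀ + jumpCount y u - j : ℕ) : ℝ) / c) volume a b :=
  (monotone_stage hc hy j).intervalIntegrable

theorem stageWork_sub (hc : 0 < c) (hy : IsJumpSequence y) (j : ℕ) (s t : ℝ) :
    stageWork c n₀ y j t - stageWork c n₀ y j s =
      ∫ u in s..t, ((n₀ + jumpCount y u - j : ℕ) : ℝ) / c :=
  intervalIntegral.integral_interval_sub_left (intervalIntegrable_stage hc hy j _ _)
    (intervalIntegrable_stage hc hy j _ _)

theorem monotone_stageWork (hc : 0 < c) (hy : IsJumpSequence y) (j : ℕ) :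
    Monotone (stageWork c n₀ y j) := fun s t hst => by
  rw [← sub_nonneg, stageWork_sub hc hy]
  exact intervalIntegral.integral_nonneg hst fun u _ => by positivity

theorem continuous_stageWork (hc : 0 < c) (hy : IsJumpSequence y) (j : ℕ) :
    Continuous (stageWork c n₀ y j) :=
  intervalIntegral.continuous_primitive (fun a b => intervalIntegrable_stage hc hy j a b) 0

theorem stageWork_zero (j : ℕ) : stageWork c n₀ y j 0 = 0 := intervalIntegral.integral_same

/-- After the arrival instant `y (j + 1)` the stage speed is at least `1 / c`, so the work grows at
least linearly. -/
theorem tendsto_stageWork (hc : 0 < c) (hy : IsJumpSequence y) (j : ℕ) :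
    Tendsto (stageWork c n₀ y j) atTop atTop := by
  have h : Tendsto (fun t => (t - y (j + 1)) * (1 / c)) atTop atTop :=
    (tendsto_atTop_add_const_right _ _ tendsto_id).atTop_mul_const (by positivity)
  refine tendsto_atTop_mono' _ ?_ h
  filter_upwards [eventually_ge_atTop (y (j + 1))] with t ht
  have h₁ : (t - y (j + 1)) * (1 / c) ≤ stageWork c n₀ y j t - stageWork c n₀ y j (y (j + 1)) := by
    rw [stageWork_sub hc hy, ← smul_eq_mul, ← intervalIntegral.integral_const]
    refine intervalIntegral.integral_mono_on ht intervalIntegrable_const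
      (intervalIntegrable_stage hc hy j _ _) fun u hu => ?_
    have h₂ : j + 1 ≤ jumpCount y u := (hy.le_jumpCount_iff ((hy.nonneg _).trans hu.1)).2 hu.1
    refine div_le_div_of_nonneg_right ?_ hc.le
    exact_mod_cast (by omega : 1 ≤ n₀ + jumpCount y u - j)
  have h₃ := monotone_stageWork (n₀ := n₀) hc hy j (hy.nonneg (j + 1))
  rw [stageWork_zero] at h₃
  linarith

theorem exists_lt_iff_apply_lt {f : ℝ → ℝ} (hm : Monotone f) (hf : Continuous f)
    (ht : Tendsto f atTop atTop) {L : ℝ} (h₀ : f 0 < L) :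
    ∃ s, 0 < s ∧ ∀ u, u < s ↔ f u < L := by
  obtain ⟨b, hb⟩ := (ht.eventually_ge_atTop L).exists
  have hne : {u | L ≤ f u}.Nonempty := ⟨b, hb⟩
  have hbd : BddBelow {u | L ≤ f u} := ⟨0, fun u hu => by
    by_contra! h
    exact absurd (hm h.le) (not_le.2 (h₀.trans_le hu))⟩
  have hmem : L ≤ f (sInf {u | L ≤ f u}) :=
    (isClosed_le continuous_const hf).csInf_mem hne hbd
  have key : ∀ u, u < sInf {u | L ≤ f u} ↔ f u < L := fun u => by
    constructor
    · intro h
      by_contra! h'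
      exact absurd (csInf_le hbd h') (not_le.2 h)
    · intro h
      by_contra! h'
      exact absurd (hmem.trans (hm h')) (not_le.2 h)
  exact ⟨_, (key 0).2 h₀, key⟩

theorem departure_nonneg (j : ℕ) : 0 ≤ departure c n₀ y w j := by
  cases j
  · exact le_rfl
  · exact ENNReal.toReal_nonneg

/-- The set in the definition of `departure` is `[0, s)` with `s` the first time the stage work
reaches its target, so its volume is `s`. -/
theorem lt_departure_succ_iff (hc : 0 < c) (hy : IsJumpSequence y) (hw : IsJumpSequence w) (j : ℕ)
    {t : ℝ} : t < departure c n₀ y w (j + 1) ↔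
      stageWork c n₀ y j t < stageWork c n₀ y j (departure c n₀ y w j) + (w (j + 1) - w j) := by
  have h₀ : stageWork c n₀ y j 0 <
      stageWork c n₀ y j (departure c n₀ y w j) + (w (j + 1) - w j) := by
    have := monotone_stageWork (n₀ := n₀) hc hy j (departure_nonneg (c := c) (n₀ := n₀) (y := y) (w := w) j)
    linarith [hw.strictMono (Nat.lt_succ_self j)]
  obtain ⟨s, hs, key⟩ := exists_lt_iff_apply_lt (monotone_stageWork hc hy j)
    (continuous_stageWork hc hy j) (tendsto_stageWork hc hy j) h₀
  have : departure c n₀ y w (j + 1) = s := by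
    have hset : {u : ℝ | 0 ≤ u ∧ stageWork c n₀ y j u <
        stageWork c n₀ y j (departure c n₀ y w j) + (w (j + 1) - w j)} = Set.Ico 0 s := by
      ext u
      simp [← key]
    rw [departure, hset, Real.volume_Ico, sub_zero, ENNReal.toReal_ofReal hs.le]
  rw [this, key]

theorem stageWork_departure_succ (hc : 0 < c) (hy : IsJumpSequence y) (hw : IsJumpSequence w)
    (j : ℕ) : stageWork c n₀ y j (departure c n₀ y w (j + 1)) =
      stageWork c n₀ y j (departure c n₀ y w j) + (w (j + 1) - w j) := by
  refine le_antisymm ?_ (not_lt.1 fun h => lt_irrefl _ ((lt_departure_succ_iff hc hy hw j).2 h))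
  refine le_of_tendsto ((continuous_stageWork hc hy j).continuousWithinAt
    (s := Set.Iio (departure c n₀ y w (j + 1)))) ?_
  filter_upwards [self_mem_nhdsWithin] with t ht
  exact ((lt_departure_succ_iff hc hy hw j).1 ht).le

theorem departure_lt_succ (hc : 0 < c) (hy : IsJumpSequence y) (hw : IsJumpSequence w) (j : ℕ) :
    departure c n₀ y w j < departure c n₀ y w (j + 1) :=
  (lt_departure_succ_iff hc hy hw j).2 (by linarith [hw.strictMono (Nat.lt_succ_self j)])

/-- Otherwise the truncated speed would vanish up to this departure, and the positive work required
by the job could not have been done. Thus truncated subtraction loses nothing in `occupancy`. -/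
theorem le_add_jumpCount_departure (hc : 0 < c) (hy : IsJumpSequence y) (hw : IsJumpSequence w)
    (j : ℕ) : j ≤ n₀ + jumpCount y (departure c n₀ y w j) := by
  cases j with
  | zero => exact Nat.zero_le _
  | succ j =>
    by_contra! h
    have hpos := stageWork_departure_succ (n₀ := n₀) hc hy hw j
    have h₀ := monotone_stageWork (n₀ := n₀) hc hy j
      (departure_nonneg (c := c) (n₀ := n₀) (y := y) (w := w) j)
    have hz : stageWork c n₀ y j (departure c n₀ y w (j + 1)) = 0 := by
      unfold stageWork
      rw [intervalIntegral.integral_congr (g := fun _ => (0 : ℝ)),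
        intervalIntegral.integral_zero]
      intro u hu
      rw [Set.uIcc_of_le (departure_nonneg _)] at hu
      have := hy.monotone_jumpCount hu.2
      simp [show n₀ + jumpCount y u - j = 0 by omega]
    rw [stageWork_zero] at h₀
    linarith [hw.strictMono (Nat.lt_succ_self j)]

theorem le_of_departure_le (hc : 0 < c) (hy : IsJumpSequence y) (hw : IsJumpSequence w) {j : ℕ}
    {t : ℝ} (h : departure c n₀ y w j ≤ t) : j ≤ n₀ + jumpCount y t :=
  (le_add_jumpCount_departure hc hy hw j).trans
    (Nat.add_le_add_left (hy.monotone_jumpCount h) _)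

theorem isJumpSequence_departure (hc : 0 < c) (hy : IsJumpSequence y) (hw : IsJumpSequence w) :
    IsJumpSequence (departure c n₀ y w) where
  strictMono := strictMono_nat_of_lt_succ (departure_lt_succ hc hy hw)
  zero := rfl
  tendsto := tendsto_atTop.2 fun t => by
    filter_upwards [eventually_gt_atTop (n₀ + jumpCount y t)] with j hj
    by_contra! h
    exact absurd (le_of_departure_le hc hy hw h.le) (not_le.2 hj)

theorem jumpCount_departure_le (hc : 0 < c) (hy : IsJumpSequence y) (hw : IsJumpSequence w) {t : ℝ}
    (ht : 0 ≤ t) : jumpCount (departure c n₀ y w) t ≤ n₀ + jumpCount y t :=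
  le_of_departure_le hc hy hw ((isJumpSequence_departure hc hy hw).apply_jumpCount_le ht)

/-! ### Work along a path, and uniqueness of the departures. -/

/-- The work done by time `t` along an occupancy path. -/
noncomputable def workDone (c : ℝ) (n : ℝ → ℕ) (t : ℝ) : ℝ := ∫ u in (0 : ℝ)..t, (n u : ℝ) / c

theorem intervalIntegrable_of_le (hc : 0 < c) (hy : IsJumpSequence y) {n : ℝ → ℕ}
    (hn : Measurable n) (hle : ∀ t, 0 ≤ t → n t ≤ n₀ + jumpCount y t) {a b : ℝ} (ha : 0 ≤ a)
    (hb : 0 ≤ b) : IntervalIntegrable (fun u => (n u : ℝ) / c) volume a b := by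
  refine (intervalIntegrable_stage (n₀ := n₀) hc hy 0 a b).mono_fun
    ((measurable_from_nat (f := fun k : ℕ => (k : ℝ) / c)).comp hn).aestronglyMeasurable ?_
  filter_upwards [ae_restrict_mem measurableSet_uIoc] with u hu
  have hu0 : 0 ≤ u := (le_min ha hb).trans hu.1.le
  have := hle u hu0
  rw [Real.norm_of_nonneg (by positivity), Real.norm_of_nonneg (by positivity)]
  refine div_le_div_of_nonneg_right ?_ hc.le
  exact_mod_cast (by omega)

theorem workDone_sub (hc : 0 < c) (hy : IsJumpSequence y) {n : ℝ → ℕ}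
    (hn : Measurable n) (hle : ∀ t, 0 ≤ t → n t ≤ n₀ + jumpCount y t) {s t : ℝ} (hs : 0 ≤ s)
    (ht : 0 ≤ t) : workDone c n t - workDone c n s = ∫ u in s..t, (n u : ℝ) / c :=
  intervalIntegral.integral_interval_sub_left (intervalIntegrable_of_le hc hy hn hle le_rfl ht)
    (intervalIntegrable_of_le hc hy hn hle le_rfl hs)

theorem workDone_mono (hc : 0 < c) (hy : IsJumpSequence y) {n : ℝ → ℕ}
    (hn : Measurable n) (hle : ∀ t, 0 ≤ t → n t ≤ n₀ + jumpCount y t) {s t : ℝ} (hs : 0 ≤ s)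
    (hst : s ≤ t) : workDone c n s ≤ workDone c n t := by
  rw [← sub_nonneg, workDone_sub hc hy hn hle hs (hs.trans hst)]
  exact intervalIntegral.integral_nonneg hst fun u _ => by positivity

theorem workDone_sub_le (hc : 0 < c) (hy : IsJumpSequence y) {n : ℝ → ℕ}
    (hn : Measurable n) (hle : ∀ t, 0 ≤ t → n t ≤ n₀ + jumpCount y t) {s t : ℝ} (hs : 0 ≤ s)
    (hst : s ≤ t) {j : ℕ} (h : ∀ u, s ≤ u → n u ≤ n₀ + jumpCount y u - j) :
    workDone c n t - workDone c n s ≤ stageWork c n₀ y j t - stageWork c n₀ y j s := by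
  rw [workDone_sub hc hy hn hle hs (hs.trans hst), stageWork_sub hc hy]
  refine intervalIntegral.integral_mono_on hst
    (intervalIntegrable_of_le hc hy hn hle hs (hs.trans hst)) (intervalIntegrable_stage hc hy j _ _)
    fun u hu => div_le_div_of_nonneg_right ?_ hc.le
  exact_mod_cast h u hu.1

theorem workDone_sub_eq (hc : 0 < c) (hy : IsJumpSequence y) {n : ℝ → ℕ}
    (hn : Measurable n) (hle : ∀ t, 0 ≤ t → n t ≤ n₀ + jumpCount y t) {s t : ℝ} (hs : 0 ≤ s)
    (hst : s ≤ t) {j : ℕ} (h : ∀ u, s ≤ u → u < t → n u = n₀ + jumpCount y u - j) :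
    workDone c n t - workDone c n s = stageWork c n₀ y j t - stageWork c n₀ y j s := by
  rw [workDone_sub hc hy hn hle hs (hs.trans hst), stageWork_sub hc hy]
  refine intervalIntegral.integral_congr_Ioo_of_le hst fun u hu => ?_
  simp only [h u hu.1.le hu.2]

/-- Along every path satisfying the balance equation the departures are those of `departure`. -/
theorem le_workDone_iff (hc : 0 < c) (hy : IsJumpSequence y) (hw : IsJumpSequence w) {n : ℝ → ℕ}
    (hn : Measurable n)
    (hbal : ∀ t, 0 ≤ t → n t + jumpCount w (workDone c n t) = n₀ + jumpCount y t) (j : ℕ) :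
    (∀ t, 0 ≤ t → (w j ≤ workDone c n t ↔ departure c n₀ y w j ≤ t)) ∧
      workDone c n (departure c n₀ y w j) = w j := by
  have hle : ∀ t, 0 ≤ t → n t ≤ n₀ + jumpCount y t := fun t ht => by have := hbal t ht; omega
  have hV : ∀ t, 0 ≤ t → 0 ≤ workDone c n t := fun t ht => by
    have := workDone_mono hc hy hn hle le_rfl ht
    rwa [workDone, intervalIntegral.integral_same] at this
  induction j with
  | zero =>
    refine ⟨fun t ht => iff_of_true (hw.zero ▸ hV t ht) ht, ?_⟩
    simp [departure, workDone, hw.zero]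
  | succ j ih =>
    obtain ⟨ih, ihV⟩ := ih
    set d := departure c n₀ y w with hd
    have hd0 : 0 ≤ d j := departure_nonneg j
    have hdd : d j < d (j + 1) := departure_lt_succ hc hy hw j
    have hww := hw.strictMono (Nat.lt_succ_self j)
    have hcount : ∀ u, d j ≤ u → j ≤ jumpCount w (workDone c n u) := fun u hu =>
      (hw.le_jumpCount_iff (hV u (hd0.trans hu))).2 ((ih u (hd0.trans hu)).2 hu)
    -- After `d j` at least `j` jobs have left, so the stage speed dominates the true speed even
    -- past the next departure.
    have hup : ∀ t, d j ≤ t → workDone c n t ≤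
        w j + (stageWork c n₀ y j t - stageWork c n₀ y j (d j)) := fun t ht => by
      have := workDone_sub_le (n₀ := n₀) hc hy hn hle hd0 ht (j := j) fun u hu => by
        have := hcount u hu
        have := hbal u (hd0.trans hu)
        omega
      linarith
    have hiff : ∀ t, 0 ≤ t → (w (j + 1) ≤ workDone c n t ↔ d (j + 1) ≤ t) := by
      intro t ht
      constructor
      · intro h
        by_contra! hlt
        have hjt : d j ≤ t := (ih t ht).1 (hww.le.trans h)
        have := (lt_departure_succ_iff hc hy hw j).1 hlt
        linarith [hup t hjt]
      · intro h
        by_contra! hlt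
        have hjt : d j ≤ t := hdd.le.trans h
        -- While the work stays below `w (j + 1)` exactly `j` jobs have left, so true and stage
        -- speeds agree; by time `d (j + 1)` the stage work has met its target, a contradiction.
        have heq := workDone_sub_eq (n₀ := n₀) hc hy hn hle hd0 hjt (j := j) fun u hu hut => by
          have hu0 := hd0.trans hu
          have h₁ := hw.jumpCount_eq (hV u hu0) ((ih u hu0).2 hu)
            ((workDone_mono hc hy hn hle hu0 hut.le).trans_lt hlt)
          have := hbal u hu0
          omega
        have := mt (lt_departure_succ_iff (n₀ := n₀) hc hy hw j).2 (not_lt.2 h)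
        linarith
    refine ⟨hiff, le_antisymm ?_ ((hiff _ (departure_nonneg _)).2 le_rfl)⟩
    have := stageWork_departure_succ (n₀ := n₀) hc hy hw j
    linarith [hup _ hdd.le]

theorem jumpCount_workDone (hc : 0 < c) (hy : IsJumpSequence y) (hw : IsJumpSequence w) {n : ℝ → ℕ}
    (hn : Measurable n)
    (hbal : ∀ t, 0 ≤ t → n t + jumpCount w (workDone c n t) = n₀ + jumpCount y t) {t : ℝ}
    (ht : 0 ≤ t) : jumpCount w (workDone c n t) = jumpCount (departure c n₀ y w) t := by
  unfold jumpCount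
  congr 1
  ext k
  exact (le_workDone_iff hc hy hw hn hbal (k + 1)).1 t ht

/-! ### Existence of a solution. -/

/-- The occupancy path with the given arrivals and sizes. -/
noncomputable def occupancy (c : ℝ) (n₀ : ℕ) (y w : ℕ → ℝ) (t : ℝ) : ℕ :=
  n₀ + jumpCount y t - jumpCount (departure c n₀ y w) t

theorem measurable_occupancy (hc : 0 < c) (hy : IsJumpSequence y) (hw : IsJumpSequence w) :
    Measurable (occupancy c n₀ y w) :=
  (measurable_const.add hy.measurable_jumpCount).sub
    (isJumpSequence_departure hc hy hw).measurable_jumpCount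

/-- Between consecutive departures `occupancy` is exactly the stage occupancy, so its work
increments are those of `stageWork`, and the values at departures telescope. -/
theorem workDone_occupancy_departure (hc : 0 < c) (hy : IsJumpSequence y) (hw : IsJumpSequence w)
    (j : ℕ) : workDone c (occupancy c n₀ y w) (departure c n₀ y w j) = w j ∧
      ∀ t, 0 ≤ t → t < departure c n₀ y w (j + 1) →
        workDone c (occupancy c n₀ y w) t < w (j + 1) := by
  have hn := measurable_occupancy (n₀ := n₀) hc hy hw
  have hd := isJumpSequence_departure (n₀ := n₀) hc hy hw
  have hle : ∀ t, 0 ≤ t → occupancy c n₀ y w t ≤ n₀ + jumpCount y t := fun t _ => Nat.sub_le _ _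
  have hinc : ∀ j t, departure c n₀ y w j ≤ t → t ≤ departure c n₀ y w (j + 1) →
      workDone c (occupancy c n₀ y w) t - workDone c (occupancy c n₀ y w) (departure c n₀ y w j) =
        stageWork c n₀ y j t - stageWork c n₀ y j (departure c n₀ y w j) := fun j t h₁ h₂ =>
    workDone_sub_eq hc hy hn hle (departure_nonneg j) h₁ fun u hu hut => by
      rw [occupancy, hd.jumpCount_eq ((departure_nonneg j).trans hu) hu (hut.trans_le h₂)]
  have hV : workDone c (occupancy c n₀ y w) (departure c n₀ y w j) = w j := by
    induction j with
    | zero => simp [departure, workDone, hw.zero]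
    | succ j ih =>
      have h₁ := hinc j _ (departure_lt_succ hc hy hw j).le le_rfl
      have h₂ := stageWork_departure_succ (n₀ := n₀) hc hy hw j
      linarith
  refine ⟨hV, fun t ht hlt => ?_⟩
  rcases le_total (departure c n₀ y w j) t with h | h
  · have h₁ := hinc j t h hlt.le
    have h₂ := (lt_departure_succ_iff hc hy hw j).1 hlt
    linarith
  · have := workDone_mono hc hy hn hle ht h
    linarith [hw.strictMono (Nat.lt_succ_self j)]

theorem occupancy_balance (hc : 0 < c) (hy : IsJumpSequence y) (hw : IsJumpSequence w) {t : ℝ}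
    (ht : 0 ≤ t) : occupancy c n₀ y w t + jumpCount w (workDone c (occupancy c n₀ y w) t) =
      n₀ + jumpCount y t := by
  have : jumpCount w (workDone c (occupancy c n₀ y w) t) = jumpCount (departure c n₀ y w) t := by
    unfold jumpCount
    congr 1
    ext k
    constructor
    · intro h
      by_contra! h'
      exact absurd h (not_le.2 ((workDone_occupancy_departure hc hy hw k).2 t ht (not_le.1 h')))
    · intro h
      have h₁ : departure c n₀ y w (k + 1) ≤ t := h
      exact (workDone_occupancy_departure hc hy hw (k + 1)).1.symm.le.trans
        (workDone_mono hc hy (measurable_occupancy hc hy hw) (fun t _ => Nat.sub_le _ _)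
          (departure_nonneg _) h₁)
  rw [this, occupancy, Nat.sub_add_cancel (jumpCount_departure_le hc hy hw ht)]

end

/-! ### Long-run rates and the average cost. -/

theorem tendsto_natCast_div_atTop {M : ℝ → ℕ} {l : ℝ} (hl : 0 < l)
    (hM : Tendsto (fun t => (M t : ℝ) / t) atTop (𝓝 l)) : Tendsto M atTop atTop := by
  rw [← tendsto_natCast_atTop_iff (R := ℝ)]
  refine (hM.pos_mul_atTop hl tendsto_id).congr' ?_
  filter_upwards [eventually_gt_atTop 0] with t ht
  simp only [id]
  field_simp

theorem tendsto_apply_div {w : ℕ → ℝ} (hw : Tendsto (fun m : ℕ => w m / m) atTop (𝓝 1))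
    {M : ℝ → ℕ} {l : ℝ} (hl : 0 < l) (hM : Tendsto (fun t => (M t : ℝ) / t) atTop (𝓝 l)) :
    Tendsto (fun t => w (M t) / t) atTop (𝓝 l) := by
  have h := tendsto_natCast_div_atTop hl hM
  have h₁ := (hw.comp h).mul hM
  rw [one_mul] at h₁
  refine h₁.congr' ?_
  filter_upwards [h.eventually_gt_atTop 0] with t ht
  have : (M t : ℝ) ≠ 0 := by exact_mod_cast ht.ne'
  simp only [Function.comp]
  field_simp

theorem tendsto_natCast_add_div {M : ℝ → ℕ} {l : ℝ}
    (hM : Tendsto (fun t => (M t : ℝ) / t) atTop (𝓝 l)) (k : ℕ) :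
    Tendsto (fun t => ((M t + k : ℕ) : ℝ) / t) atTop (𝓝 l) := by
  have := hM.add (tendsto_const_nhds (x := (k : ℝ)) |>.div_atTop tendsto_id)
  rw [add_zero] at this
  refine this.congr fun t => ?_
  simp only [id]
  push_cast
  ring

theorem tendsto_sub_sqrt : Tendsto (fun t : ℝ => t - √t) atTop atTop := by
  have h : Tendsto (fun t : ℝ => √t * (√t - 1)) atTop atTop :=
    Real.tendsto_sqrt_atTop.atTop_mul_atTop₀
      (tendsto_atTop_add_const_right _ _ Real.tendsto_sqrt_atTop)
  refine h.congr' ?_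
  filter_upwards [eventually_ge_atTop 0] with t ht
  rw [mul_sub, Real.mul_self_sqrt ht, mul_one]

section

variable {c : ℝ} {n₀ : ℕ} {y w : ℕ → ℝ} {n : ℝ → ℕ}

theorem workDone_nonneg (hc : 0 < c) {t : ℝ} (ht : 0 ≤ t) : 0 ≤ workDone c n t :=
  intervalIntegral.integral_nonneg ht fun u _ => by positivity

/-- The departure rate is at least the arrival rate, because a backlog of linear order would be
cleared in a time of order `√t`. -/
theorem le_jumpCount_workDone (hc : 0 < c) (hy : IsJumpSequence y) (hw : IsJumpSequence w)
    (hn : Measurable n)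
    (hbal : ∀ t, 0 ≤ t → n t + jumpCount w (workDone c n t) = n₀ + jumpCount y t) {s t : ℝ}
    (hs : 0 ≤ s) (hst : s ≤ t) :
    (t - s) * (((jumpCount y s : ℝ) - jumpCount w (workDone c n t)) / c) ≤ workDone c n t := by
  have hle : ∀ t, 0 ≤ t → n t ≤ n₀ + jumpCount y t := fun t ht => by have := hbal t ht; omega
  -- On `[s, t]` the occupancy is at least the arrivals by `s` minus the departures by `t`.
  have h : (t - s) * (((jumpCount y s : ℝ) - jumpCount w (workDone c n t)) / c) ≤
      workDone c n t - workDone c n s := by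
    rw [workDone_sub hc hy hn hle hs (hs.trans hst), ← smul_eq_mul,
      ← intervalIntegral.integral_const]
    refine intervalIntegral.integral_mono_on hst intervalIntegrable_const
      (intervalIntegrable_of_le hc hy hn hle hs (hs.trans hst)) fun u hu => ?_
    have h₁ := hbal u (hs.trans hu.1)
    have h₂ := hy.monotone_jumpCount hu.1
    have h₃ := hw.monotone_jumpCount (workDone_mono hc hy hn hle (hs.trans hu.1) hu.2)
    refine div_le_div_of_nonneg_right ?_ hc.le
    rify at h₁ h₂ h₃
    have : (0 : ℝ) ≤ n₀ := Nat.cast_nonneg _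
    linarith
  linarith [workDone_nonneg (n := n) hc hs]

/-- The upper bound is `D ≤ n₀ + A`. For the lower one, `le_jumpCount_workDone` is applied on `[t -
√t, t]`: the window is `o(t)`, so dropping its arrivals does not change the rate, yet it tends to
infinity, so total work of order `t` bounds `A(t - √t) - D(t)` by order `√t`. -/
theorem tendsto_jumpCount_workDone_div (hc : 0 < c) (hy : IsJumpSequence y) (hw : IsJumpSequence w)
    {a : ℝ} (ha : 0 < a) (hya : Tendsto (fun m : ℕ => y m / m) atTop (𝓝 a))
    (hw1 : Tendsto (fun m : ℕ => w m / m) atTop (𝓝 1)) (hn : Measurable n)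
    (hbal : ∀ t, 0 ≤ t → n t + jumpCount w (workDone c n t) = n₀ + jumpCount y t) :
    Tendsto (fun t => (jumpCount w (workDone c n t) : ℝ) / t) atTop (𝓝 a⁻¹) := by
  have ha' : 0 < a⁻¹ := inv_pos.2 ha
  have hA := hy.tendsto_jumpCount_div ha hya
  have hM : Tendsto (fun t => w (jumpCount y t + (n₀ + 1)) / t) atTop (𝓝 a⁻¹) :=
    tendsto_apply_div hw1 ha' (tendsto_natCast_add_div hA (n₀ + 1))
  have hsq : Tendsto (fun t : ℝ => (√t)⁻¹) atTop (𝓝 0) :=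
    tendsto_inv_atTop_zero.comp Real.tendsto_sqrt_atTop
  have hlow : Tendsto (fun t => (jumpCount y (t - √t) : ℝ) / (t - √t) * (1 - (√t)⁻¹) -
      c * (w (jumpCount y t + (n₀ + 1)) / t * (√t)⁻¹)) atTop (𝓝 (a⁻¹ * (1 - 0) - c * (a⁻¹ * 0))) :=
    ((hA.comp tendsto_sub_sqrt).mul (tendsto_const_nhds.sub hsq)).sub
      ((hM.mul hsq).const_mul c)
  rw [sub_zero, mul_one, mul_zero, mul_zero, sub_zero] at hlow
  refine tendsto_of_tendsto_of_tendsto_of_le_of_le' hlow (tendsto_natCast_add_div hA n₀) ?_ ?_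
  · filter_upwards [eventually_gt_atTop 1] with t ht
    have ht0 : 0 < t := by linarith
    have hsqrt : √t * √t = t := Real.mul_self_sqrt ht0.le
    have hs1 : 1 < √t := by rw [Real.lt_sqrt zero_le_one]; simpa using ht
    have hst : √t < t := by nlinarith
    have h₁ := le_jumpCount_workDone hc hy hw hn hbal (sub_nonneg.2 hst.le)
      (by linarith : t - √t ≤ t)
    have h₂ : workDone c n t ≤ w (jumpCount y t + (n₀ + 1)) := by
      refine (hw.lt_apply_jumpCount_succ (workDone_nonneg hc ht0.le)).le.trans
        (hw.strictMono.monotone ?_)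
      have := hbal t ht0.le
      omega
    set A : ℝ := (jumpCount y (t - √t) : ℝ)
    set D : ℝ := (jumpCount w (workDone c n t) : ℝ)
    set W := w (jumpCount y t + (n₀ + 1))
    have h₃ : √t * (A - D) ≤ c * W := by
      rw [sub_sub_cancel, ← mul_div_assoc, div_le_iff₀ hc] at h₁
      nlinarith
    have h₄ : A / (t - √t) * (1 - (√t)⁻¹) = A / t := by
      have : t - √t ≠ 0 := (sub_pos.2 hst).ne'
      have h0 : √t ≠ 0 := by positivity
      field_simp
      linear_combination A * hsqrt
    rw [h₄, div_mul_eq_mul_div, ← mul_div_assoc, ← sub_div]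
    refine div_le_div_of_nonneg_right ?_ ht0.le
    have h0 : 0 < √t := by positivity
    have h₅ : A - D ≤ c * W / √t := by rw [le_div_iff₀ h0]; linarith
    rw [← mul_assoc, ← div_eq_mul_inv]
    linarith
  · filter_upwards [eventually_gt_atTop 0] with t ht
    refine div_le_div_of_nonneg_right ?_ ht.le
    have := hbal t ht.le
    exact_mod_cast (by omega)

/-- The work lies between `w D` and `w (D + 1)`, where `D` is the departure count, and `w m / m →
1`. -/
theorem tendsto_workDone_div (hc : 0 < c) (hy : IsJumpSequence y) (hw : IsJumpSequence w)
    {a : ℝ} (ha : 0 < a) (hya : Tendsto (fun m : ℕ => y m / m) atTop (𝓝 a))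
    (hw1 : Tendsto (fun m : ℕ => w m / m) atTop (𝓝 1)) (hn : Measurable n)
    (hbal : ∀ t, 0 ≤ t → n t + jumpCount w (workDone c n t) = n₀ + jumpCount y t) :
    Tendsto (fun t => workDone c n t / t) atTop (𝓝 a⁻¹) := by
  have ha' : 0 < a⁻¹ := inv_pos.2 ha
  have hD := tendsto_jumpCount_workDone_div hc hy hw ha hya hw1 hn hbal
  refine tendsto_of_tendsto_of_tendsto_of_le_of_le' (tendsto_apply_div hw1 ha' hD)
    (tendsto_apply_div hw1 ha' (tendsto_natCast_add_div hD 1)) ?_ ?_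
  · filter_upwards [eventually_gt_atTop 0] with t ht
    exact div_le_div_of_nonneg_right (hw.apply_jumpCount_le (workDone_nonneg hc ht.le)) ht.le
  · filter_upwards [eventually_gt_atTop 0] with t ht
    exact div_le_div_of_nonneg_right
      (hw.lt_apply_jumpCount_succ (workDone_nonneg hc ht.le)).le ht.le

theorem lintegral_occupancy (hc : 0 < c) (hy : IsJumpSequence y)
    (hn : Measurable n) (hle : ∀ t, 0 ≤ t → n t ≤ n₀ + jumpCount y t) {t : ℝ} (ht : 0 ≤ t) :
    ∫⁻ u in Set.Icc (0 : ℝ) t, (n u : ℝ≥0∞) = ENNReal.ofReal (c * workDone c n t) := by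
  have hint := intervalIntegrable_of_le hc hy hn hle le_rfl ht
  rw [workDone, ← intervalIntegral.integral_const_mul, intervalIntegral.integral_of_le ht,
    ofReal_integral_eq_lintegral_ofReal (hint.const_mul c).1
      (ae_of_all _ fun u => by positivity), restrict_Ioc_eq_restrict_Icc]
  refine lintegral_congr fun u => ?_
  rw [mul_div_cancel₀ _ hc.ne', ENNReal.ofReal_natCast]

theorem tendsto_averageCost {α : ℝ} (hα : 0 < α) {p : Policy} (hp : ∀ i, p.rate i = i / c)
    (hc : 0 < c) (hy : IsJumpSequence y) (hw : IsJumpSequence w)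
    {a : ℝ} (ha : 0 < a) (hya : Tendsto (fun m : ℕ => y m / m) atTop (𝓝 a))
    (hw1 : Tendsto (fun m : ℕ => w m / m) atTop (𝓝 1))
    (hties : ∀ i j, departure c n₀ y w (i + 1) ≠ y (j + 1)) (hn : Measurable n)
    (hbal : ∀ t, 0 ≤ t → n t + jumpCount w (workDone c n t) = n₀ + jumpCount y t) :
    Tendsto (averageCost α p n) atTop (𝓝 (ENNReal.ofReal ((c + 2 * α / c ^ 2) * a⁻¹))) := by
  have hle : ∀ t, 0 ≤ t → n t ≤ n₀ + jumpCount y t := fun t ht => by have := hbal t ht; omega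
  have hA := hy.tendsto_jumpCount_div ha hya
  have hD := tendsto_jumpCount_workDone_div hc hy hw ha hya hw1 hn hbal
  have hV := tendsto_workDone_div hc hy hw ha hya hw1 hn hbal
  have hlim := (hV.const_mul c).add ((hA.add hD).const_mul (α / c ^ 2))
  have heq : c * a⁻¹ + α / c ^ 2 * (a⁻¹ + a⁻¹) = (c + 2 * α / c ^ 2) * a⁻¹ := by ring
  rw [heq] at hlim
  refine (ENNReal.tendsto_ofReal hlim).congr' ?_
  filter_upwards [eventually_gt_atTop 0] with t ht
  have hdep : ∀ u, 0 ≤ u →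
      n u + jumpCount (departure c n₀ y w) u = n₀ + jumpCount y u := fun u hu => by
    rw [← jumpCount_workDone hc hy hw hn hbal hu, hbal u hu]
  have hV0 := workDone_nonneg (n := n) hc ht.le
  unfold averageCost
  simp_rw [hp]
  rw [lintegral_occupancy hc hy hn hle ht.le,
    switchingCost_eq hy (isJumpSequence_departure hc hy hw) hties hdep,
    ← jumpCount_workDone hc hy hw hn hbal ht.le, ← ENNReal.ofReal_div_of_pos ht,
    ← ENNReal.ofReal_div_of_pos ht, ← ENNReal.ofReal_mul hα.le,
    ← ENNReal.ofReal_add (by positivity) (by positivity)]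
  congr 1
  ring

theorem isOccupancyPath_iff {p : Policy} (hp : ∀ i, p.rate i = i / c) {gap size : ℕ → ℝ}
    (hy : IsJumpSequence (partialSum gap)) (hw : IsJumpSequence (partialSum size)) :
    IsOccupancyPath p n₀ gap size n ↔ Measurable n ∧ ∀ t, 0 ≤ t →
      n t + jumpCount (partialSum size) (workDone c n t) =
        n₀ + jumpCount (partialSum gap) t := by
  have h : ∀ t, ((n t : ℕ∞) + countUpTo size (∫ u in (0 : ℝ)..t, p.rate (n u)) =
      n₀ + countUpTo gap t) ↔ n t + jumpCount (partialSum size) (workDone c n t) =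
        n₀ + jumpCount (partialSum gap) t := fun t => by
    simp_rw [hp]
    rw [countUpTo_eq hy, countUpTo_eq hw, ← workDone]
    norm_cast
  exact ⟨fun ⟨h₁, h₂⟩ => ⟨h₁, fun t ht => (h t).1 (h₂ t ht)⟩,
    fun ⟨h₁, h₂⟩ => ⟨h₁, fun t ht => (h t).2 (h₂ t ht)⟩⟩

end

/-! ### Exponential laws, the strong law, and independence. -/

theorem expMeasure_Iic_zero (r : ℝ) : expMeasure r (Set.Iic 0) = 0 := by
  rw [← Set.Iio_union_right, measure_union_null_iff]
  refine ⟨?_, ?_⟩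
  · rw [expMeasure, gammaMeasure, withDensity_apply _ measurableSet_Iio]
    exact lintegral_gammaPDF_of_nonpos le_rfl
  · exact withDensity_absolutelyContinuous _ _ (by simp)

theorem expMeasure_singleton (r x : ℝ) : expMeasure r {x} = 0 :=
  withDensity_absolutelyContinuous _ _ (by simp)

theorem integral_expMeasure {r : ℝ} (hr : 0 < r) : ∫ x, x ∂(expMeasure r) = r⁻¹ := by
  have hm : Measurable (gammaPDF 1 r) := (measurable_gammaPDFReal 1 r).ennreal_ofReal
  rw [expMeasure, gammaMeasure, integral_withDensity_eq_integral_toReal_smul hm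
    (ae_of_all _ fun _ => ENNReal.ofReal_lt_top)]
  have h : ∀ x : ℝ, (gammaPDF 1 r x).toReal • x =
      (Set.Ioi (0 : ℝ)).indicator (fun x => r * (x ^ ((2 : ℝ) - 1) * Real.exp (-(r * x)))) x := by
    intro x
    rw [gammaPDF, ENNReal.toReal_ofReal (gammaPDFReal_nonneg one_pos hr x), gammaPDFReal,
      smul_eq_mul, Set.indicator_apply]
    by_cases hx : 0 < x
    · rw [if_pos hx.le, if_pos (Set.mem_Ioi.2 hx)]
      norm_num
      ring
    · rw [if_neg (show x ∉ Set.Ioi (0 : ℝ) from hx)]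
      rcases (not_lt.1 hx).lt_or_eq with hx | rfl
      · rw [if_neg (not_le.2 hx), zero_mul]
      · exact mul_zero _
  simp_rw [h]
  rw [integral_indicator measurableSet_Ioi, integral_const_mul,
    Real.integral_rpow_mul_exp_neg_mul_Ioi two_pos hr, Real.Gamma_two, mul_one, Real.rpow_two]
  field_simp

/-- The Bochner integral of a non-integrable function is zero, whereas this mean is `r⁻¹ > 0`. -/
theorem integrable_expMeasure {r : ℝ} (hr : 0 < r) : Integrable (fun x : ℝ => x) (expMeasure r) := by
  by_contra h
  have := integral_expMeasure hr
  rw [integral_undef h] at this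
  exact (inv_pos.2 hr).ne this

section

variable {Ω : Type*} [mΩ : MeasurableSpace Ω] {P : Measure Ω}

theorem ae_tendsto_partialSum_div {r : ℝ} (hr : 0 < r) {X : ℕ → Ω → ℝ}
    (hlaw : ∀ k, HasLaw (X k) (expMeasure r) P) (hindep : iIndepFun X P) :
    ∀ᵐ ω ∂P, Tendsto (fun m : ℕ => partialSum (fun k => X k ω) m / m) atTop (𝓝 r⁻¹) := by
  have hint : Integrable (X 0) P :=
    (((hlaw 0).map_eq ▸ integrable_expMeasure hr).comp_aemeasurable (hlaw 0).aemeasurable :)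
  have h := strong_law_ae_real X hint (fun i j hij => hindep.indepFun hij)
    fun i => (hlaw i).identDistrib (hlaw 0)
  rwa [(hlaw 0).integral_eq, integral_expMeasure hr] at h

theorem ae_pos_of_hasLaw {r : ℝ} {X : ℕ → Ω → ℝ} (hlaw : ∀ k, HasLaw (X k) (expMeasure r) P) :
    ∀ᵐ ω ∂P, ∀ k, 0 < X k ω := by
  refine ae_all_iff.2 fun k => ?_
  rw [ae_iff]
  simp_rw [not_lt]
  rw [(hlaw k).measure_eq (p := fun x => x ≤ 0) measurableSet_Iic]
  exact expMeasure_Iic_zero r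

/-- A random variable without atoms almost surely differs from an independent one. -/
theorem ae_ne_of_indepFun [IsProbabilityMeasure P] {X Y : Ω → ℝ} (hX : AEMeasurable X P)
    (hY : AEMeasurable Y P) (hXY : IndepFun Y X P) (h : ∀ x, P.map X {x} = 0) :
    ∀ᵐ ω ∂P, X ω ≠ Y ω := by
  have hdiag : MeasurableSet {q : ℝ × ℝ | q.2 = q.1} :=
    measurableSet_eq_fun measurable_snd measurable_fst
  have := Measure.isProbabilityMeasure_map hX
  have := Measure.isProbabilityMeasure_map hY
  have h₀ : (P.map fun ω => (Y ω, X ω)) {q : ℝ × ℝ | q.2 = q.1} = 0 := by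
    rw [hXY.map_prod_eq_prod_map_map hY hX, Measure.measure_prod_null hdiag]
    exact ae_of_all _ fun y => h y
  rw [Measure.map_apply_of_aemeasurable (hY.prodMk hX) hdiag] at h₀
  rw [ae_iff]
  simpa using h₀

/-- A variable determined by all members but one of an independent family is independent of the
remaining one. -/
theorem indepFun_of_forall_measurable {ι : Type*} {f : ι → Ω → ℝ} (h : iIndepFun f P)
    (hf : ∀ i, Measurable (f i)) {j : ι} {Y : Ω → ℝ}
    (hY : ∀ m : MeasurableSpace Ω, (∀ i ≠ j, Measurable[m] (f i)) → Measurable[m] Y) :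
    IndepFun Y (f j) P := by
  -- `hY` will be applied to the σ-algebra generated by the members other than `f j`.
  have hind := indep_iSup_of_disjoint (fun i => (hf i).comap_le)
    ((iIndepFun_iff_iIndep _ _ _).1 h) (S := {i | i ≠ j}) (T := {j}) (by simp)
  rw [IndepFun_iff_Indep]
  refine indep_of_indep_of_le_left (indep_of_indep_of_le_right hind ?_)
    (hY _ fun i hi => ?_).comap_le
  · exact le_iSup₂_of_le j rfl le_rfl
  · exact (comap_measurable (f i)).mono (le_iSup₂_of_le i hi le_rfl) le_rfl

end

/-! ### Measurable dependence of the departures on the input. -/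

section

variable {Ω : Type*} {m : MeasurableSpace Ω}

theorem measurable_jumpCount_prod {y : ℕ → Ω → ℝ} (hy : ∀ k, Measurable (y k)) :
    Measurable fun q : Ω × ℝ => jumpCount (fun k => y k q.1) q.2 :=
  measurable_ncard.comp (measurable_set_iff.2 fun k =>
    measurableSet_setOfPred.1 (measurableSet_le ((hy (k + 1)).comp measurable_fst) measurable_snd))

theorem measurable_stageWork {c : ℝ} {n₀ j : ℕ} {y : ℕ → Ω → ℝ} (hy : ∀ k, Measurable (y k)) :
    Measurable fun q : Ω × ℝ => stageWork c n₀ (fun k => y k q.1) j q.2 := by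
  have hf : Measurable fun q : (Ω × ℝ) × ℝ =>
      ((n₀ + jumpCount (fun k => y k q.1.1) q.2 - j : ℕ) : ℝ) / c :=
    (measurable_from_nat (f := fun k : ℕ => ((n₀ + k - j : ℕ) : ℝ) / c)).comp
      ((measurable_jumpCount_prod hy).comp ((measurable_fst.comp measurable_fst).prodMk
        measurable_snd))
  -- An integral with variable endpoints is a parametric integral of an indicator; the interval
  -- integral is a difference of two such.
  have key : ∀ a b : Ω × ℝ → ℝ, Measurable a → Measurable b → Measurable fun q : Ω × ℝ =>
      ∫ u in Set.Ioc (a q) (b q), ((n₀ + jumpCount (fun k => y k q.1) u - j : ℕ) : ℝ) / c := by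
    intro a b ha hb
    have hs : MeasurableSet {q : (Ω × ℝ) × ℝ | a q.1 < q.2 ∧ q.2 ≤ b q.1} :=
      (measurableSet_lt (ha.comp measurable_fst) measurable_snd).inter
        (measurableSet_le measurable_snd (hb.comp measurable_fst))
    have := (hf.indicator hs).stronglyMeasurable.integral_prod_right' (ν := volume)
    convert this.measurable using 2 with q
    rw [← integral_indicator measurableSet_Ioc]
    rfl
  exact (key _ _ measurable_const measurable_snd).sub (key _ _ measurable_snd measurable_const)

theorem measurable_stageWork_comp {c : ℝ} {n₀ j : ℕ} {y : ℕ → Ω → ℝ} (hy : ∀ k, Measurable (y k))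
    {T : Ω → ℝ} (hT : Measurable T) :
    Measurable fun ω => stageWork c n₀ (fun k => y k ω) j (T ω) := by
  have h : Measurable fun ω : Ω => (ω, T ω) := measurable_id.prodMk hT
  have h' := (measurable_stageWork (c := c) (n₀ := n₀) (j := j) hy).comp h
  simp only [Function.comp_def] at h'
  exact h'

/-- Defining `departure` as a volume makes this the measurability of section measures. Only `w k`
with `k ≤ j` enter, which later gives independence of the next size. -/
theorem measurable_departure {c : ℝ} {n₀ : ℕ} {y w : ℕ → Ω → ℝ} (hy : ∀ k, Measurable (y k))
    {j : ℕ} (hw : ∀ k ≤ j, Measurable (w k)) :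
    Measurable fun ω => departure c n₀ (fun k => y k ω) (fun k => w k ω) j := by
  induction j with
  | zero => exact measurable_const
  | succ j ih =>
    have ih := ih fun k hk => hw k (hk.trans (Nat.le_succ j))
    have hL : Measurable fun ω => stageWork c n₀ (fun k => y k ω) j
        (departure c n₀ (fun k => y k ω) (fun k => w k ω) j) + (w (j + 1) ω - w j ω) :=
      (measurable_stageWork_comp hy ih).add
        ((hw _ le_rfl).sub (hw _ (Nat.le_succ j)))
    have hs : MeasurableSet {q : Ω × ℝ | 0 ≤ q.2 ∧ stageWork c n₀ (fun k => y k q.1) j q.2 <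
        stageWork c n₀ (fun k => y k q.1) j
          (departure c n₀ (fun k => y k q.1) (fun k => w k q.1) j) +
          (w (j + 1) q.1 - w j q.1)} :=
      (measurableSet_le measurable_const measurable_snd).inter
        (measurableSet_lt (measurable_stageWork hy) (hL.comp measurable_fst))
    exact (measurable_measure_prodMk_left (ν := volume) hs).ennreal_toReal

theorem measurable_stageWork_sub {c : ℝ} {n₀ : ℕ} {y w : ℕ → Ω → ℝ} (hy : ∀ k, Measurable (y k))
    {j : ℕ} (hw : ∀ k ≤ j, Measurable (w k)) (i : ℕ) :
    Measurable fun ω => stageWork c n₀ (fun k => y k ω) j (y i ω) -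
      stageWork c n₀ (fun k => y k ω) j (departure c n₀ (fun k => y k ω) (fun k => w k ω) j) :=
  (measurable_stageWork_comp hy (hy i)).sub
    (measurable_stageWork_comp hy (measurable_departure hy hw))

theorem measurable_partialSum {x : ℕ → Ω → ℝ} {k : ℕ} (hx : ∀ i < k, Measurable (x i)) :
    Measurable fun ω => partialSum (fun i => x i ω) k :=
  Finset.measurable_fun_sum _ fun i hi => hx i (Finset.mem_range.1 hi)

end

/-! ### Almost sure regularity of the input and absence of ties. -/

section

variable {Ω : Type*} [mΩ : MeasurableSpace Ω] {P : Measure Ω}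
  {lam : ℝ} {gap size : ℕ → Ω → ℝ}

theorem IsPoissonExpInput.congr (h : IsPoissonExpInput P lam gap size) {gap' size' : ℕ → Ω → ℝ}
    (hg : ∀ k, gap k =ᵐ[P] gap' k) (hs : ∀ k, size k =ᵐ[P] size' k) :
    IsPoissonExpInput P lam gap' size' where
  gap_law k := (h.gap_law k).congr (hg k).symm
  size_law k := (h.size_law k).congr (hs k).symm
  indep := h.indep.congr fun i => by
    cases i
    · exact hg _
    · exact hs _

/-- The size of the `j`-th job is independent of the arrivals and the sizes of the previous jobs. -/
theorem IsPoissonExpInput.ae_size_ne [IsProbabilityMeasure P] (h : IsPoissonExpInput P lam gap size)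
    (hg : ∀ k, Measurable (gap k)) (hs : ∀ k, Measurable (size k)) (c : ℝ) (n₀ j i : ℕ) :
    ∀ᵐ ω ∂P, size j ω ≠
      stageWork c n₀ (partialSum fun k => gap k ω) j (partialSum (fun k => gap k ω) (i + 1)) -
      stageWork c n₀ (partialSum fun k => gap k ω) j
        (departure c n₀ (partialSum fun k => gap k ω) (partialSum fun k => size k ω) j) := by
  have hf : ∀ i : ℕ ⊕ ℕ, Measurable (Sum.elim gap size i) := by
    rintro (k | k)
    · exact hg k
    · exact hs k
  have hY : ∀ m : MeasurableSpace Ω, (∀ i ≠ Sum.inr j, Measurable[m] (Sum.elim gap size i)) →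
      Measurable[m] fun ω =>
        stageWork c n₀ (partialSum fun k => gap k ω) j (partialSum (fun k => gap k ω) (i + 1)) -
        stageWork c n₀ (partialSum fun k => gap k ω) j
          (departure c n₀ (partialSum fun k => gap k ω) (partialSum fun k => size k ω) j) :=
    fun m hm => measurable_stageWork_sub
      (fun k => measurable_partialSum (k := k) fun i _ => hm (Sum.inl i) Sum.inl_ne_inr)
      -- For `k ≤ j` the accumulated size involves only sizes of index below `j`, never `size j`
      -- itself.
      (fun k hk => measurable_partialSum (k := k) fun i hi => hm (Sum.inr i) fun h =>
        (hi.trans_le hk).ne (Sum.inr_injective h)) (i + 1)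
  refine ae_ne_of_indepFun (hs j).aemeasurable
    (hY _ fun i _ => hf i).aemeasurable
    (indepFun_of_forall_measurable h.indep hf hY) fun x => ?_
  rw [(h.size_law j).map_eq]
  exact expMeasure_singleton 1 x

theorem IsPoissonExpInput.ae_regular (h : IsPoissonExpInput P lam gap size) (hlam : 0 < lam) :
    ∀ᵐ ω ∂P, IsJumpSequence (partialSum fun k => gap k ω) ∧
      IsJumpSequence (partialSum fun k => size k ω) ∧
      Tendsto (fun m : ℕ => partialSum (fun k => gap k ω) m / m) atTop (𝓝 lam⁻¹) ∧
      Tendsto (fun m : ℕ => partialSum (fun k => size k ω) m / m) atTop (𝓝 1) := by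
  have hg := ae_tendsto_partialSum_div hlam h.gap_law (h.indep.precomp (g := Sum.inl) Sum.inl_injective)
  have hs := ae_tendsto_partialSum_div one_pos h.size_law (h.indep.precomp (g := Sum.inr) Sum.inr_injective)
  filter_upwards [hg, hs, ae_pos_of_hasLaw h.gap_law, ae_pos_of_hasLaw h.size_law]
    with ω h₁ h₂ h₃ h₄
  rw [inv_one] at h₂
  exact ⟨isJumpSequence_partialSum h₃ (inv_pos.2 hlam) h₁,
    isJumpSequence_partialSum h₄ one_pos h₂, h₁, h₂⟩

/-- At a tie `stageWork_departure_succ` expresses `size j` as the work excluded by `ae_size_ne`.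
Measurable modifications are taken since the laws give only a.e. measurability. -/
theorem IsPoissonExpInput.ae_departure_ne [IsProbabilityMeasure P]
    (h : IsPoissonExpInput P lam gap size) (hlam : 0 < lam)
    {c : ℝ} (hc : 0 < c) (n₀ : ℕ) :
    ∀ᵐ ω ∂P, ∀ j i,
      departure c n₀ (partialSum fun k => gap k ω) (partialSum fun k => size k ω) (j + 1) ≠
        partialSum (fun k => gap k ω) (i + 1) := by
  have hg := fun k => (h.gap_law k).aemeasurable
  have hs := fun k => (h.size_law k).aemeasurable
  have h' := h.congr (fun k => (hg k).ae_eq_mk) (fun k => (hs k).ae_eq_mk)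
  filter_upwards [h.ae_regular hlam, ae_all_iff.2 fun k => (hg k).ae_eq_mk,
    ae_all_iff.2 fun k => (hs k).ae_eq_mk, ae_all_iff.2 fun j => ae_all_iff.2 fun i =>
      h'.ae_size_ne (fun k => (hg k).measurable_mk) (fun k => (hs k).measurable_mk) c n₀ j i]
    with ω hreg hgω hsω hne j i heq
  refine hne j i ?_
  simp_rw [← hgω, ← hsω]
  rw [← heq, stageWork_departure_succ hc hreg.1 hreg.2.1 j]
  simp [partialSum, Finset.sum_range_succ]

end

end SpeedScaling

theorem mainTheorem11 {Ω : Type*} [MeasurableSpace Ω] (P : Measure Ω) [IsProbabilityMeasure P]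
    (lam α : ℝ) (hlam : 0 < lam) (hα : 0 < α) (gap size : ℕ → Ω → ℝ)
    (hinput : SpeedScaling.IsPoissonExpInput P lam gap size) (n₀ : ℕ) :
    SpeedScaling.HasLongRunCost P gap size α (SpeedScaling.proportionalSpeed α hα) n₀
      (3 / 2 * (4 * α) ^ (1 / 3 : ℝ) * lam) := by
  open SpeedScaling in
  set c : ℝ := (4 * α) ^ (1 / 3 : ℝ) with hc_def
  have hc : 0 < c := by positivity
  have hc3 : c ^ 3 = 4 * α := by
    rw [hc_def, ← Real.rpow_natCast, ← Real.rpow_mul (by positivity)]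
    norm_num
  have hp : ∀ i, (proportionalSpeed α hα).rate i = i / c := fun i => rfl
  -- `c ^ 3 = 4α` means `2α / c ^ 2 = c / 2`.
  have hC : (c + 2 * α / c ^ 2) * (lam⁻¹)⁻¹ = 3 / 2 * c * lam := by
    rw [inv_inv]
    field_simp
    linear_combination -hc3
  refine ⟨by positivity, ?_⟩
  filter_upwards [hinput.ae_regular hlam, hinput.ae_departure_ne hlam hc n₀]
    with ω ⟨hy, hw, hya, hw1⟩ hties
  refine ⟨⟨_, (isOccupancyPath_iff hp hy hw).2 ⟨measurable_occupancy hc hy hw,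
    fun t ht => occupancy_balance hc hy hw ht⟩⟩, fun n hn => ?_⟩
  obtain ⟨hn, hbal⟩ := (isOccupancyPath_iff hp hy hw).1 hn
  rw [← hC]
  exact tendsto_averageCost hα hp hc hy hw (inv_pos.2 hlam) hya hw1 hties hn hbal
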